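/- Let $d\ge 2$ and let $\mu=(\mu_1,\dots,\mu_d)$ be integers with $\mu_1\ge\dots\ge\mu_d\ge 0$, $\mu_1+\dots+\mu_d=n$ and $\mu_2>0$. Let $|1\rangle,\dots,|d\rangle$ be the standard basis of $\mathbb{C}^d$, write $\binom{n}{\mu}=\frac{n!}{\mu_1!\cdots\mu_d!}$ and $p^*(\mu)=\frac{1}{1+\binom{n}{\mu}}$, and define on $(\mathbb{C}^d)^{\otimes n}$ $$\rho_{=}^{n}=\int U^{\otimes n}|1^n\rangle\langle 1^n|(U^\dagger)^{\otimes n}\,dU,\qquad \rho_{\neq}^{\mu}=\int U^{\otimes n}|1^{\mu_1}2^{\mu_2}\cdots d^{\mu_d}\rangle\langle 1^{\mu_1}2^{\mu_2}\cdots d^{\mu_d}|(U^\dagger)^{\otimes n}\,dU,$$ where $|1^{\mu_1}2^{\mu_2}\cdots d^{\mu_d}\rangle=|1\rangle^{\otimes\mu_1}\otimes\cdots\otimes|d\rangle^{\otimes\mu_d}$ and $dU$ is the Haar probability measure on the unitary group $\mathrm{U}(d)$. Let $\Pi_{(n)}=\frac{1}{n!}\sum_{\pi\in S_n}\psi(\pi)$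 be the projector onto the symmetric subspace, where $\psi(\pi)$ permutes the tensor factors. For $p\in[0,1]$ consider the semidefinite program $$\text{maximize}\quad p\,\mathrm{Tr}[\Pi_{=}\rho_{=}^{n}]+(1-p)\,\mathrm{Tr}[\Pi_{\neq}\rho_{\neq}^{\mu}]\quad\text{subject to}\quad \Pi_{=}+\Pi_{\neq}=\mathbb{1},\ \Pi_{=}\succeq 0,\ \Pi_{\neq}\succeq 0 .$$ Its objective is the average success probability $\mathbb{P}_{succ}$ of discriminating the two states when the equal state $\rho_{=}^{n}$ has prior probability $p$; $\mathbb{P}_{c}=\mathrm{Tr}[\Pi_{=}\rho_{=}^{n}]$ is the completeness and $\mathbb{P}_{s}=\mathrm{Tr}[\Pi_{\neq}\rho_{\neq}^{\mu}]$ the soundness. Then: (i) If $p^*(\mu)\le p\le 1$, the permutation test $\Pi_{=}=\Pi_{(n)}$, $\Pi_{\neq}=\mathbb{1}-\Pi_{(n)}$ is an optimal solution, with $\mathbb{P}_{succ}=1-\frac{1-p}{\binom{n}{\mu}}$, $\mathbb{P}_{c}=1$ and $\mathbb{P}_{s}=1-\frac{1}{\binom{n}{\mu}}$. (ii) If $0\le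 p\le p^*(\mu)$, the trivial test $\Pi_{=}=0$, $\Pi_{\neq}=\mathbb{1}$ ("always not equal") is an optimal solution, with $\mathbb{P}_{succ}=1-p$, $\mathbb{P}_{c}=0$ and $\mathbb{P}_{s}=1$. -/

import Mathlib

open scoped BigOperators ComplexOrder

namespace QuantumIdentity

/-! ### Haar probability measure on the unitary group `U(d)` -/

/-- The Borel σ-algebra on the unitary group `U(d)`. -/
noncomputable instance unitaryMeasurableSpace (d : ℕ) : MeasurableSpace (Matrix.unitaryGroup (Fin d) ℂ) :=
  borel _

instance unitaryBorelSpace (d : ℕ) : BorelSpace (Matrix.unitaryGroup (Fin d) ℂ) :=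
  ⟨rfl⟩

instance unitaryCompactSpace (d : ℕ) : CompactSpace (Matrix.unitaryGroup (Fin d) ℂ) := by
  suffices h : IsCompact (Matrix.unitaryGroup (Fin d) ℂ : Set (Matrix (Fin d) (Fin d) ℂ)) from
    isCompact_iff_compactSpace.mp h
  have hK : IsCompact (Set.pi Set.univ fun _ : Fin d =>
      Set.pi Set.univ fun _ : Fin d => Metric.closedBall (0 : ℂ) 1) :=
    isCompact_univ_pi fun _ => isCompact_univ_pi fun _ => isCompact_closedBall _ _
  refine hK.of_isClosed_subset (isClosed_unitary (R := Matrix (Fin d) (Fin d) ℂ)) ?_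
  intro U hU i _ j _
  rw [mem_closedBall_zero_iff]
  exact entry_norm_bound_of_unitary hU i j

/-- The Haar measure on `U(d)`, normalized so that the whole (compact) group has measure `1`. -/
noncomputable def haarUnitary (d : ℕ) :
    MeasureTheory.Measure (Matrix.unitaryGroup (Fin d) ℂ) :=
  MeasureTheory.Measure.haarMeasure ⊤

instance haarUnitary_isHaarMeasure (d : ℕ) : (haarUnitary d).IsHaarMeasure := by
  unfold haarUnitary
  infer_instance

instance haarUnitary_isProbabilityMeasure (d : ℕ) :
    MeasureTheory.IsProbabilityMeasure (haarUnitary d) :=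
  ⟨by
    have h := MeasureTheory.Measure.haarMeasure_self
      (K₀ := (⊤ : TopologicalSpace.PositiveCompacts (Matrix.unitaryGroup (Fin d) ℂ)))
    simpa [haarUnitary] using h⟩

/-! ### Operators on `(ℂ^d)^{⊗ n}` -/

/-- Operators on `(ℂ^d)^{⊗ n}`, written as matrices in the product basis
`|x⟩ = |x 0⟩ ⊗ ⋯ ⊗ |x (n-1)⟩`, `x : Fin n → Fin d`. -/
abbrev Op (n d : ℕ) : Type := Matrix (Fin n → Fin d) (Fin n → Fin d) ℂ

/-- The tensor power `A^{⊗ n}`. -/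
def tensorPow (n : ℕ) {d : ℕ} (A : Matrix (Fin d) (Fin d) ℂ) : Op n d :=
  Matrix.of fun x y => ∏ k, A (x k) (y k)

/-- The operator `ψ(π)` permuting the tensor factors:
`ψ(π) |x 0, …, x (n-1)⟩ = |x (π⁻¹ 0), …, x (π⁻¹ (n-1))⟩`. -/
def permOp (n d : ℕ) (π : Equiv.Perm (Fin n)) : Op n d :=
  Matrix.of fun x y => if x = y ∘ ⇑π⁻¹ then 1 else 0

/-- The projector `Π_(n) = (1/n!) ∑_π ψ(π)` onto the symmetric subspace of `(ℂ^d)^{⊗ n}`. -/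
noncomputable def symProj (n d : ℕ) : Op n d :=
  ((n.factorial : ℂ)⁻¹) • ∑ π : Equiv.Perm (Fin n), permOp n d π

/-- The rank-one projector `|w⟩⟨w|` onto a product basis vector. -/
def basisProj {n d : ℕ} (w : Fin n → Fin d) : Op n d :=
  Matrix.single w w 1

/-- The Haar twirl `∫ U^{⊗ n} |w⟩⟨w| (U^†)^{⊗ n} dU`, integrated entry by entry. -/
noncomputable def haarTwirl {n d : ℕ} (w : Fin n → Fin d) : Op n d :=
  Matrix.of fun x y =>
    ∫ U : Matrix.unitaryGroup (Fin d) ℂ,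
      (tensorPow n (U : Matrix (Fin d) (Fin d) ℂ) * basisProj w *
        tensorPow n (U : Matrix (Fin d) (Fin d) ℂ).conjTranspose) x y ∂(haarUnitary d)

/-- The word `1^{μ₁} 2^{μ₂} ⋯ d^{μ_d}`: the first `μ₁` letters are the first basis label, the
next `μ₂` letters the second one, and so on. -/
def blockWord {n d : ℕ} (μ : Fin d → ℕ) (hμ : ∑ i, μ i = n) (k : Fin n) : Fin d :=
  (finSigmaFinEquiv.symm (Fin.cast hμ.symm k)).1

/-- The Haar-twirled equal state `ρ_=^n = ∫ U^{⊗ n} |1^n⟩⟨1^n| (U^†)^{⊗ n} dU`. -/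
noncomputable def rhoEq (n d : ℕ) (hd : 0 < d) : Op n d :=
  haarTwirl fun _ => ⟨0, hd⟩

/-- The Haar-twirled unequal state
`ρ_≠^μ = ∫ U^{⊗ n} |1^{μ₁} ⋯ d^{μ_d}⟩⟨1^{μ₁} ⋯ d^{μ_d}| (U^†)^{⊗ n} dU`. -/
noncomputable def rhoNeq {n d : ℕ} (μ : Fin d → ℕ) (hμ : ∑ i, μ i = n) : Op n d :=
  haarTwirl (blockWord μ hμ)

/-! ### Discrimination of two states -/

/-- `{P, Q}` is a two-outcome POVM. -/
def IsPOVM {n d : ℕ} (P Q : Op n d) : Prop :=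
  P + Q = 1 ∧ P.PosSemidef ∧ Q.PosSemidef

/-- The Born-rule probability `Tr[P ρ]`; the trace is real for the Hermitian operators
`P` and `ρ` it is applied to. -/
noncomputable def outcomeProb {n d : ℕ} (P ρ : Op n d) : ℝ :=
  (P * ρ).trace.re

/-- The objective of the discrimination SDP: the average success probability
`p Tr[P ρ₀] + (1 - p) Tr[Q ρ₁]` when `ρ₀` has prior probability `p`. -/
noncomputable def successProb {n d : ℕ} (p : ℝ) (ρ₀ ρ₁ P Q : Op n d) : ℝ :=
  p * outcomeProb P ρ₀ + (1 - p) * outcomeProb Q ρ₁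

/-- `{P, Q}` is an optimal solution of the discrimination SDP: it is a POVM, and no POVM has a
larger average success probability. -/
def IsOptimalPOVM {n d : ℕ} (p : ℝ) (ρ₀ ρ₁ P Q : Op n d) : Prop :=
  IsPOVM P Q ∧ ∀ P' Q' : Op n d, IsPOVM P' Q' →
    successProb p ρ₀ ρ₁ P' Q' ≤ successProb p ρ₀ ρ₁ P Q

/-- The multinomial coefficient `n! / (μ₁! ⋯ μ_d!)`, where `n = μ₁ + ⋯ + μ_d`, as a real
number. -/
def multinom {d : ℕ} (μ : Fin d → ℕ) : ℝ :=
  (Nat.multinomial Finset.univ μ : ℝ)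

/-- The threshold prior `p^*(μ) = 1 / (1 + binom(n, μ))`. -/
noncomputable def thresholdPrior {d : ℕ} (μ : Fin d → ℕ) : ℝ :=
  1 / (1 + multinom μ)

end QuantumIdentity

/-! Write `Π` for the projector onto the symmetric subspace, `T_w` for the Haar twirl of `|w⟩⟨w|`
and `M` for the multinomial coefficient. The whole argument rests on the operator inequality
`ρ_≠ ⪰ ρ_= / M` (`posSemidef_haarTwirl_sub`).

It comes from the irreducibility of the symmetric subspace, which is obtained by hand for the
operators `T_w`. By invariance of the Haar measure, `T_w` commutes with every `V^{⊗ n}`. Commutation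
with diagonal phases shows that `|1^n⟩` is an eigenvector of `T_w`, say with eigenvalue `c_w`
(`haarTwirl_apply_const_of_ne`). Since every vector `z` is a multiple of the first column of a
unitary, all `z^{⊗ n}` are eigenvectors with the same eigenvalue (`sum_haarTwirl_mul_prod`), and
polarization (`sum_perm_eq_zero_of_forall_sum_prod_eq_zero`) gives `T_w Π = c_w Π`. Comparing traces,
`T_w Π = ⟨w|Π|w⟩ ρ_=`, where `⟨w|Π|w⟩ = 1 / M` for the block word `w`. Hence
`ρ_≠ - ρ_= / M = (1 - Π) ρ_≠ (1 - Π)` is positive semidefinite.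

For a POVM `{P, Q}` with completeness `t = Tr[P ρ_=] ∈ [0, 1]` the inequality bounds the success
probability by `1 - p + (p - (1 - p) / M) t` (`successProb_le`). The coefficient of `t` is
nonnegative exactly when `p ≥ 1 / (1 + M)`, so the bound is largest at `t = 1` or at `t = 0`, and
these values are attained by the permutation test and by the trivial test. -/

namespace QuantumIdentity
open Matrix

variable {n d : ℕ}

/-! ### Polarization and unitaries with a prescribed column -/

/-- Polarization: a linear functional `a` on the tensors that vanishes on all powers `z^{⊗ n}`
vanishes on the symmetrization of every basis tensor `w`. With `z = ∑ j, t j • e_{w j}` the hypothesis is a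
polynomial identity in `t`, and the conclusion is its coefficient at `t 0 ⋯ t (n-1)`. -/
theorem sum_perm_eq_zero_of_forall_sum_prod_eq_zero {ι : Type*} [Fintype ι] [DecidableEq ι]
    (a : (Fin n → ι) → ℂ)
    (h : ∀ z : ι → ℂ, ∑ y, a y * ∏ k, z (y k) = 0) (w : Fin n → ι) :
    ∑ π : Equiv.Perm (Fin n), a (w ∘ π) = 0 := by
  classical
  set ones : Fin n →₀ ℕ := ∑ j, Finsupp.single j 1 with hones
  set Q : MvPolynomial (Fin n) ℂ :=
    ∑ σ : Fin n → Fin n, MvPolynomial.C (a (w ∘ σ)) * ∏ k, MvPolynomial.X (σ k) with hQ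
  -- The substitution `z i = ∑_{w j = i} t j` turns the hypothesis into `Q = 0`.
  have hQ0 : Q = 0 := by
    refine MvPolynomial.funext fun t => ?_
    have h' := h fun i => ∑ j, if w j = i then t j else 0
    simp only [Fintype.prod_sum, Finset.prod_ite_zero, Finset.mul_sum] at h'
    rw [Finset.sum_comm] at h'
    rw [map_zero, ← h', hQ, map_sum]
    refine Finset.sum_congr rfl fun σ _ => ?_
    rw [Finset.sum_eq_single (w ∘ σ)]
    · simp
    · intro y _ hy
      rw [if_neg, mul_zero]
      exact fun hc => hy (funext fun k => (hc k (Finset.mem_univ _)).symm)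
    · simp
  have hones_apply : ∀ i, ones i = 1 := fun i => by
    simp [hones, Finsupp.finsetSum_apply, Finsupp.single_apply]
  have hcoeff : ∀ σ : Fin n → Fin n,
      MvPolynomial.coeff ones (MvPolynomial.C (a (w ∘ σ)) * ∏ k, MvPolynomial.X (σ k))
        = if Function.Bijective σ then a (w ∘ σ) else 0 := by
    intro σ
    have hX : (∏ k, MvPolynomial.X (σ k) : MvPolynomial (Fin n) ℂ)
        = MvPolynomial.monomial (∑ k, Finsupp.single (σ k) 1) 1 := by
      rw [MvPolynomial.monomial_sum_one]
      rfl
    rw [MvPolynomial.coeff_C_mul, hX, MvPolynomial.coeff_monomial]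
    by_cases hσ : Function.Bijective σ
    · rw [if_pos hσ, if_pos, mul_one]
      rw [hones]
      exact hσ.sum_comp fun j => Finsupp.single j 1
    · rw [if_neg hσ, if_neg, mul_zero]
      intro hc
      refine hσ (Finite.surjective_iff_bijective.mp fun i => ?_)
      by_contra! hi
      have := hones_apply i
      rw [← hc, Finsupp.finsetSum_apply] at this
      simp [hi] at this
  have hc := congrArg (MvPolynomial.coeff ones) hQ0
  rw [hQ, MvPolynomial.coeff_sum, MvPolynomial.coeff_zero] at hc
  simp only [hcoeff] at hc
  rw [← hc, ← Finset.sum_filter]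
  refine (Finset.sum_bij (fun σ hσ => Equiv.ofBijective σ (Finset.mem_filter.1 hσ).2)
    (fun _ _ => Finset.mem_univ _) (fun σ _ τ _ hst => ?_) (fun π _ => ?_) fun _ _ => rfl).symm
  · exact congrArg DFunLike.coe hst
  · exact ⟨π, Finset.mem_filter.2 ⟨Finset.mem_univ _, π.bijective⟩, Equiv.ext fun _ => rfl⟩

/-- Every vector is a multiple of a given column of some unitary matrix. -/
theorem exists_unitary_col_eq_smul (i₀ : Fin d) (z : Fin d → ℂ) :
    ∃ V ∈ Matrix.unitaryGroup (Fin d) ℂ, ∃ r : ℂ, ∀ i, z i = r * V i i₀ := by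
  by_cases hz : z = 0
  · exact ⟨1, one_mem _, 0, by simp [hz]⟩
  have hv : WithLp.toLp 2 z ≠ 0 := by simpa using hz
  set v : EuclideanSpace ℂ (Fin d) := WithLp.toLp 2 z with hvdef
  have hn : (‖v‖ : ℂ) ≠ 0 := by simpa using hv
  obtain ⟨b, hb⟩ := Orthonormal.exists_orthonormalBasis_extension_of_card_eq (𝕜 := ℂ)
    (E := EuclideanSpace ℂ (Fin d)) (ι := Fin d) (by simp)
    (v := fun _ => (‖v‖ : ℂ)⁻¹ • v) (s := {i₀})
    ⟨fun _ => norm_smul_inv_norm hv, fun i j hij => (hij (Subsingleton.elim i j)).elim⟩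
  refine ⟨_, (EuclideanSpace.basisFun (Fin d) ℂ).toMatrix_orthonormalBasis_mem_unitary b,
    (‖v‖ : ℂ), fun i => ?_⟩
  have : (EuclideanSpace.basisFun (Fin d) ℂ).toBasis.toMatrix b i i₀ = (‖v‖ : ℂ)⁻¹ * z i := by
    rw [Module.Basis.toMatrix_apply, hb i₀ rfl]
    simp [hvdef]
  rw [this, mul_inv_cancel_left₀ hn]

/-! ### Tensor powers and the symmetric projector -/

theorem tensorPow_mul (A B : Matrix (Fin d) (Fin d) ℂ) :
    tensorPow n (A * B) = tensorPow n A * tensorPow n B := by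
  ext x y
  simp [tensorPow, Matrix.mul_apply, Fintype.prod_sum, Finset.prod_mul_distrib]

theorem tensorPow_one : tensorPow n (1 : Matrix (Fin d) (Fin d) ℂ) = 1 := by
  ext x y
  simp [tensorPow, Matrix.one_apply, Finset.prod_ite_zero, funext_iff]

theorem tensorPow_conjTranspose (A : Matrix (Fin d) (Fin d) ℂ) :
    tensorPow n Aᴴ = (tensorPow n A)ᴴ := by
  ext x y
  simp [tensorPow]

theorem tensorPow_conjTranspose_mul_self {U : Matrix (Fin d) (Fin d) ℂ}
    (hU : U ∈ Matrix.unitaryGroup (Fin d) ℂ) :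
    tensorPow n Uᴴ * tensorPow n U = 1 := by
  rw [← tensorPow_mul, ← Matrix.star_eq_conjTranspose, Matrix.mem_unitaryGroup_iff'.1 hU,
    tensorPow_one]

theorem permOp_mul_apply (π : Equiv.Perm (Fin n)) (M : Op n d) (x y : Fin n → Fin d) :
    (permOp n d π * M) x y = M (x ∘ π) y := by
  rw [Matrix.mul_apply, Finset.sum_eq_single (x ∘ π)]
  · simp [permOp, Function.comp_assoc]
  · intro u _ hu
    have : x ≠ u ∘ ⇑π⁻¹ := by
      rintro rfl
      exact hu (by ext; simp)
    simp only [permOp, Matrix.of_apply, if_neg this, zero_mul]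
  · simp

theorem mul_permOp_apply (π : Equiv.Perm (Fin n)) (M : Op n d) (x y : Fin n → Fin d) :
    (M * permOp n d π) x y = M x (y ∘ ⇑π⁻¹) := by
  simp [Matrix.mul_apply, permOp]

theorem permOp_mul_permOp (π σ : Equiv.Perm (Fin n)) :
    permOp n d π * permOp n d σ = permOp n d (π * σ) := by
  ext x y
  rw [mul_permOp_apply]
  simp only [permOp, Matrix.of_apply, _root_.mul_inv_rev]
  rfl

theorem permOp_conjTranspose (π : Equiv.Perm (Fin n)) :
    (permOp n d π)ᴴ = permOp n d π⁻¹ := by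
  ext x y
  simp only [permOp, Matrix.conjTranspose_apply, Matrix.of_apply, inv_inv]
  have : y = x ∘ ⇑π⁻¹ ↔ x = y ∘ ⇑π := by
    constructor <;> rintro rfl <;> ext <;> simp
  simp only [this]
  split_ifs <;> simp

theorem commute_permOp_tensorPow (π : Equiv.Perm (Fin n)) (A : Matrix (Fin d) (Fin d) ℂ) :
    Commute (permOp n d π) (tensorPow n A) := by
  ext x y
  rw [permOp_mul_apply, mul_permOp_apply]
  simp only [tensorPow, Matrix.of_apply, Function.comp_apply]
  exact Fintype.prod_equiv π _ _ fun k => by simp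

theorem commute_symProj_tensorPow (A : Matrix (Fin d) (Fin d) ℂ) :
    Commute (symProj n d) (tensorPow n A) :=
  (Commute.sum_left _ _ _ fun π _ => commute_permOp_tensorPow π A).smul_left _

theorem permOp_mul_symProj (π : Equiv.Perm (Fin n)) :
    permOp n d π * symProj n d = symProj n d := by
  rw [symProj, Matrix.mul_smul, Matrix.mul_sum]
  simp only [permOp_mul_permOp]
  exact congrArg _ (Equiv.sum_comp (Equiv.mulLeft π) (permOp n d))

theorem symProj_mul_self : symProj n d * symProj n d = symProj n d := by
  have hn : (n.factorial : ℂ) ≠ 0 := by exact_mod_cast n.factorial_ne_zero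
  conv_lhs => rw [symProj, Matrix.smul_mul, Matrix.sum_mul]
  rw [← symProj]
  simp only [permOp_mul_symProj, Finset.sum_const, Finset.card_univ, Fintype.card_perm,
    Fintype.card_fin, ← Nat.cast_smul_eq_nsmul ℂ, smul_smul]
  rw [inv_mul_cancel₀ hn, one_smul]

theorem isHermitian_symProj : (symProj n d).IsHermitian := by
  rw [Matrix.IsHermitian, symProj, Matrix.conjTranspose_smul, Matrix.conjTranspose_sum]
  simp only [permOp_conjTranspose]
  rw [star_inv₀, star_natCast]
  exact congrArg _ (Equiv.sum_comp (Equiv.inv (Equiv.Perm (Fin n))) (permOp n d))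

theorem posSemidef_of_isHermitian_of_mul_self {P : Op n d} (hP : P.IsHermitian)
    (hPP : P * P = P) : P.PosSemidef := by
  have := Matrix.posSemidef_conjTranspose_mul_self P
  rwa [hP.eq, hPP] at this

theorem posSemidef_symProj : (symProj n d).PosSemidef :=
  posSemidef_of_isHermitian_of_mul_self isHermitian_symProj symProj_mul_self

theorem posSemidef_one_sub_symProj : (1 - symProj n d).PosSemidef := by
  refine posSemidef_of_isHermitian_of_mul_self (Matrix.isHermitian_one.sub isHermitian_symProj) ?_
  rw [sub_mul, mul_sub, mul_sub, symProj_mul_self]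
  simp

theorem mul_symProj_apply (M : Op n d) (x y : Fin n → Fin d) :
    (M * symProj n d) x y = (n.factorial : ℂ)⁻¹ * ∑ π : Equiv.Perm (Fin n), M x (y ∘ π) := by
  rw [symProj, Matrix.mul_smul, Matrix.mul_sum, Matrix.smul_apply, Matrix.sum_apply, smul_eq_mul]
  simp only [mul_permOp_apply]
  exact congrArg _ (Equiv.sum_comp (Equiv.inv (Equiv.Perm (Fin n)))
    fun π : Equiv.Perm (Fin n) => M x (y ∘ π))

/-- The diagonal entry at `w` is the proportion of permutations that fix `w`. -/
theorem symProj_apply_self (w : Fin n → Fin d) :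
    symProj n d w w = (n.factorial : ℂ)⁻¹ * ∏ i, ((Fintype.card {k // w k = i}).factorial : ℂ) := by
  have h := mul_symProj_apply 1 w w
  rw [one_mul] at h
  rw [h, ← Nat.cast_prod (R := ℂ), ← DomMulAct.stabilizer_card w, Fintype.card_subtype]
  simp [Matrix.one_apply, eq_comm]

/-! ### The Haar twirl -/

/-- The conjugate `U^{⊗ n} |w⟩⟨w| (U^†)^{⊗ n}` of a basis projector, the integrand of
`haarTwirl`. -/
def conjProj (w : Fin n → Fin d) (U : Matrix (Fin d) (Fin d) ℂ) : Op n d :=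
  tensorPow n U * basisProj w * tensorPow n Uᴴ

theorem conjProj_apply (w : Fin n → Fin d) (U : Matrix (Fin d) (Fin d) ℂ) (x y : Fin n → Fin d) :
    conjProj w U x y = (∏ k, U (x k) (w k)) * star (∏ k, U (y k) (w k)) := by
  rw [conjProj, tensorPow_conjTranspose, basisProj, Matrix.mul_apply,
    Finset.sum_eq_single w (fun u _ hu => by
      rw [Matrix.mul_single_apply_of_ne (hbj := hu), zero_mul]) (by simp)]
  simp [tensorPow]

theorem conjProj_eq_vecMulVec (w : Fin n → Fin d) (U : Matrix (Fin d) (Fin d) ℂ) :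
    conjProj w U
      = vecMulVec (fun x => ∏ k, U (x k) (w k)) (star fun x => ∏ k, U (x k) (w k)) := by
  ext x y
  rw [conjProj_apply, vecMulVec_apply]
  rfl

theorem posSemidef_conjProj (w : Fin n → Fin d) (U : Matrix (Fin d) (Fin d) ℂ) :
    (conjProj w U).PosSemidef := by
  rw [conjProj_eq_vecMulVec]
  exact posSemidef_vecMulVec_self_star _

theorem conjProj_mul (w : Fin n → Fin d) (V U : Matrix (Fin d) (Fin d) ℂ) :
    conjProj w (V * U) = tensorPow n V * conjProj w U * tensorPow n Vᴴ := by
  simp only [conjProj, conjTranspose_mul, tensorPow_mul, Matrix.mul_assoc]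

theorem integrable_conjProj_apply (w x y : Fin n → Fin d) :
    MeasureTheory.Integrable
      (fun U : Matrix.unitaryGroup (Fin d) ℂ => conjProj w (U : Matrix (Fin d) (Fin d) ℂ) x y)
      (haarUnitary d) := by
  refine Continuous.integrable_of_hasCompactSupport ?_ (HasCompactSupport.of_compactSpace _)
  have hU : ∀ i j, Continuous fun U : Matrix.unitaryGroup (Fin d) ℂ =>
      (U : Matrix (Fin d) (Fin d) ℂ) i j := fun i j =>
    (continuous_subtype_val (p := (· ∈ Matrix.unitaryGroup (Fin d) ℂ))).matrix_elem i j
  simp only [conjProj_apply]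
  exact (continuous_finsetProd _ fun k _ => hU _ _).mul
    (continuous_finsetProd _ fun k _ => hU _ _).star

theorem haarTwirl_apply (w x y : Fin n → Fin d) :
    haarTwirl w x y = ∫ U : Matrix.unitaryGroup (Fin d) ℂ,
      conjProj w (U : Matrix (Fin d) (Fin d) ℂ) x y ∂(haarUnitary d) := rfl

/-- Linear functionals commute with the entrywise integral defining the Haar twirl. -/
theorem map_haarTwirl (w : Fin n → Fin d) (φ : Op n d →ₗ[ℂ] ℂ) :
    φ (haarTwirl w) = ∫ U : Matrix.unitaryGroup (Fin d) ℂ,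
      φ (conjProj w (U : Matrix (Fin d) (Fin d) ℂ)) ∂(haarUnitary d) := by
  -- A functional on matrices is a finite combination of the entries.
  have key : ∀ M : Op n d, φ M = ∑ x, ∑ y, M x y * φ (Matrix.single x y 1) := by
    intro M
    conv_lhs => rw [Matrix.matrix_eq_sum_single M]
    simp only [map_sum]
    refine Finset.sum_congr rfl fun x _ => Finset.sum_congr rfl fun y _ => ?_
    rw [← smul_eq_mul, ← map_smul, Matrix.smul_single, smul_eq_mul, mul_one]
  rw [key]
  simp only [key (conjProj w _)]
  rw [MeasureTheory.integral_finsetSum _ fun x _ => MeasureTheory.integrable_finsetSum _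
    fun y _ => (integrable_conjProj_apply w x y).mul_const _]
  refine Finset.sum_congr rfl fun x _ => ?_
  rw [MeasureTheory.integral_finsetSum _ fun y _ => (integrable_conjProj_apply w x y).mul_const _]
  refine Finset.sum_congr rfl fun y _ => ?_
  rw [MeasureTheory.integral_mul_const, haarTwirl_apply]

theorem map_haarTwirl_of_const (w : Fin n → Fin d) (φ : Op n d →ₗ[ℂ] ℂ) (c : ℂ)
    (h : ∀ U ∈ Matrix.unitaryGroup (Fin d) ℂ, φ (conjProj w U) = c) :
    φ (haarTwirl w) = c := by
  rw [map_haarTwirl]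
  simp only [h _ (Subtype.prop _)]
  simp

theorem isHermitian_haarTwirl (w : Fin n → Fin d) : (haarTwirl w).IsHermitian := by
  ext x y
  rw [conjTranspose_apply, haarTwirl_apply, haarTwirl_apply, Complex.star_def, ← integral_conj]
  simp only [conjProj_apply, Complex.star_def, map_mul, Complex.conj_conj, mul_comm]

theorem posSemidef_haarTwirl (w : Fin n → Fin d) : (haarTwirl w).PosSemidef := by
  refine PosSemidef.of_dotProduct_mulVec_nonneg (isHermitian_haarTwirl w) fun v => ?_
  have := map_haarTwirl w
    ((dotProductBilin ℂ ℂ (star v)).comp ((Matrix.mulVecBilin ℂ ℂ).flip v))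
  simp only [LinearMap.comp_apply, LinearMap.flip_apply, dotProductBilin_apply_apply,
    mulVecBilin_apply] at this
  rw [this]
  exact MeasureTheory.integral_nonneg fun U => (posSemidef_conjProj w _).dotProduct_mulVec_nonneg v

theorem tensorPow_mul_haarTwirl_mul (w : Fin n → Fin d) {V : Matrix (Fin d) (Fin d) ℂ}
    (hV : V ∈ Matrix.unitaryGroup (Fin d) ℂ) :
    tensorPow n V * haarTwirl w * tensorPow n Vᴴ = haarTwirl w := by
  ext x y
  have := map_haarTwirl w
    ((Matrix.entryLinearMap ℂ ℂ x y).comp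
      ((LinearMap.mulRight ℂ (tensorPow n Vᴴ)).comp (LinearMap.mulLeft ℂ (tensorPow n V))))
  simp only [LinearMap.comp_apply, LinearMap.mulRight_apply, LinearMap.mulLeft_apply,
    Matrix.entryLinearMap_apply, ← conjProj_mul] at this
  rw [this, haarTwirl_apply]
  exact MeasureTheory.integral_mul_left_eq_self
    (fun U : Matrix.unitaryGroup (Fin d) ℂ => conjProj w (U : Matrix (Fin d) (Fin d) ℂ) x y)
    ⟨V, hV⟩

theorem haarTwirl_mul_tensorPow (w : Fin n → Fin d) {V : Matrix (Fin d) (Fin d) ℂ}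
    (hV : V ∈ Matrix.unitaryGroup (Fin d) ℂ) :
    haarTwirl w * tensorPow n V = tensorPow n V * haarTwirl w := by
  conv_lhs => rw [← tensorPow_mul_haarTwirl_mul w hV]
  rw [Matrix.mul_assoc, tensorPow_conjTranspose_mul_self hV, Matrix.mul_one]

/-! ### Irreducibility of the symmetric subspace -/

theorem trace_haarTwirl (w : Fin n → Fin d) : (haarTwirl w).trace = 1 := by
  refine map_haarTwirl_of_const w (Matrix.traceLinearMap _ ℂ ℂ) 1 fun U hU => ?_
  rw [Matrix.traceLinearMap_apply, conjProj, Matrix.trace_mul_comm, ← Matrix.mul_assoc,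
    tensorPow_conjTranspose_mul_self hU, Matrix.one_mul, basisProj, Matrix.trace_single_eq_same]

theorem trace_haarTwirl_mul_symProj (w : Fin n → Fin d) :
    (haarTwirl w * symProj n d).trace = symProj n d w w := by
  refine map_haarTwirl_of_const w
    ((Matrix.traceLinearMap _ ℂ ℂ).comp (LinearMap.mulRight ℂ (symProj n d))) _ fun U hU => ?_
  rw [LinearMap.comp_apply, LinearMap.mulRight_apply, Matrix.traceLinearMap_apply, conjProj,
    Matrix.mul_assoc, ← (commute_symProj_tensorPow Uᴴ).eq, ← Matrix.mul_assoc,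
    Matrix.trace_mul_comm, Matrix.mul_assoc, ← Matrix.mul_assoc, ← Matrix.mul_assoc,
    tensorPow_conjTranspose_mul_self hU, Matrix.one_mul, basisProj, Matrix.trace_mul_comm]
  simp [Matrix.trace_mul_single]

/-- Invariance under diagonal phases: the twirl has no matrix element between a constant word and a
different word, so a constant word is an eigenvector. -/
theorem haarTwirl_apply_const_of_ne (w : Fin n → Fin d) (i₀ : Fin d) {x : Fin n → Fin d}
    (hx : x ≠ fun _ => i₀) : haarTwirl w x (fun _ => i₀) = 0 := by
  obtain ⟨j, hj⟩ := Function.ne_iff.1 hx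
  -- Put the phase `θ = exp (iπ / m)` on a letter `x j ≠ i₀` that occurs `m ≥ 1` times in `x`. The
  -- tensor power then multiplies `x` by `θ ^ m = -1` and fixes the constant word.
  set m := (Finset.univ.filter fun k => x k = x j).card with hm
  have hm0 : (m : ℂ) ≠ 0 := by
    have : j ∈ Finset.univ.filter fun k => x k = x j := by simp
    exact_mod_cast (Finset.card_pos.2 ⟨j, this⟩).ne'
  set θ : ℂ := Complex.exp ((Real.pi / m : ℝ) * Complex.I) with hθ
  have hθm : θ ^ m = -1 := by
    rw [hθ, ← Complex.exp_nat_mul, ← Complex.exp_pi_mul_I]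
    congr 1
    push_cast
    field_simp
  have hθn : θ * star θ = 1 := by
    rw [Complex.star_def, Complex.mul_conj', hθ, Complex.norm_exp_ofReal_mul_I]
    simp
  set D : Matrix (Fin d) (Fin d) ℂ := Matrix.diagonal fun i => if i = x j then θ else 1 with hD
  have hDU : D ∈ Matrix.unitaryGroup (Fin d) ℂ := by
    rw [Matrix.mem_unitaryGroup_iff, Matrix.star_eq_conjTranspose, hD,
      Matrix.diagonal_conjTranspose, Matrix.diagonal_mul_diagonal, Matrix.diagonal_eq_one]
    ext i
    by_cases hi : i = x j
    · simpa [hi] using hθn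
    · simp [hi]
  have hDn : tensorPow n D
      = Matrix.diagonal fun y => ∏ k, if y k = x j then θ else 1 := by
    ext y z
    rw [tensorPow, Matrix.of_apply, hD]
    by_cases hyz : y = z
    · simp [hyz]
    · obtain ⟨k, hk⟩ := Function.ne_iff.1 hyz
      rw [Matrix.diagonal_apply_ne _ hyz]
      exact Finset.prod_eq_zero (Finset.mem_univ k) (Matrix.diagonal_apply_ne _ hk)
  have h := congrFun (congrFun (haarTwirl_mul_tensorPow w hDU) x) fun _ => i₀
  rw [hDn, Matrix.mul_diagonal, Matrix.diagonal_mul] at h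
  simp only [if_neg (Ne.symm hj), Finset.prod_ite, Finset.prod_const, one_pow,
    mul_one, ← hm, hθm] at h
  linear_combination h / 2

/-- All product vectors `z^{⊗ n}` are eigenvectors of the twirl, with a common eigenvalue. -/
theorem sum_haarTwirl_mul_prod (w : Fin n → Fin d) (i₀ : Fin d) (z : Fin d → ℂ)
    (x : Fin n → Fin d) :
    ∑ y, haarTwirl w x y * ∏ k, z (y k)
      = haarTwirl w (fun _ => i₀) (fun _ => i₀) * ∏ k, z (x k) := by
  obtain ⟨V, hV, r, hr⟩ := exists_unitary_col_eq_smul i₀ z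
  have h := congrFun (congrFun (haarTwirl_mul_tensorPow w hV) x) fun _ => i₀
  rw [Matrix.mul_apply, Matrix.mul_apply, Finset.sum_eq_single (fun _ => i₀)
    (fun y _ hy => by rw [haarTwirl_apply_const_of_ne w i₀ hy, mul_zero]) (by simp)
    (s := Finset.univ) (f := fun y => tensorPow n V x y * haarTwirl w y fun _ => i₀)] at h
  simp only [tensorPow, Matrix.of_apply] at h
  -- Both sides are homogeneous of degree `n` in `z`, so the factor `r` drops out.
  simp only [hr, Finset.prod_mul_distrib, Finset.prod_const, Finset.card_univ, Fintype.card_fin]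
  simp only [mul_left_comm _ (r ^ n), ← Finset.mul_sum, h]
  ring

/-- The instance of Schur's lemma that is needed: the twirl acts as a scalar on the symmetric
subspace. -/
theorem haarTwirl_mul_symProj_eq_smul (w : Fin n → Fin d) (i₀ : Fin d) :
    haarTwirl w * symProj n d
      = haarTwirl w (fun _ => i₀) (fun _ => i₀) • symProj n d := by
  rw [← sub_eq_zero, ← Matrix.one_mul (symProj n d), ← Matrix.mul_assoc, Matrix.mul_one,
    ← Matrix.smul_mul, ← Matrix.sub_mul]
  ext x y
  rw [mul_symProj_apply, sum_perm_eq_zero_of_forall_sum_prod_eq_zero _ (fun z => ?_) y]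
  · simp
  · simp only [Matrix.sub_apply, Matrix.smul_apply, sub_mul, Finset.sum_sub_distrib,
      sum_haarTwirl_mul_prod w i₀]
    simp [Matrix.one_apply]

/-- The twirl of a constant word is supported on the symmetric subspace. -/
theorem haarTwirl_const_mul_symProj (i₀ : Fin d) :
    haarTwirl (fun _ : Fin n => i₀) * symProj n d = haarTwirl fun _ => i₀ := by
  have hn : (n.factorial : ℂ) ≠ 0 := by exact_mod_cast n.factorial_ne_zero
  ext x y
  have h : ∀ π : Equiv.Perm (Fin n),
      haarTwirl (fun _ => i₀) x (y ∘ π) = haarTwirl (fun _ => i₀) x y := by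
    intro π
    simp only [haarTwirl_apply, conjProj_apply, Function.comp_apply]
    refine congrArg _ (funext fun U => ?_)
    rw [Equiv.prod_comp π fun k => (U : Matrix (Fin d) (Fin d) ℂ) (y k) i₀]
  rw [mul_symProj_apply]
  simp only [h, Finset.sum_const, Finset.card_univ, Fintype.card_perm, Fintype.card_fin,
    nsmul_eq_mul]
  rw [inv_mul_cancel_left₀ hn]

/-- The scalar by which the twirl acts on the symmetric subspace, found by comparing traces and
expressed through the twirl of a constant word. -/
theorem haarTwirl_mul_symProj (w : Fin n → Fin d) (i₀ : Fin d) :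
    haarTwirl w * symProj n d = symProj n d w w • haarTwirl (fun _ => i₀) := by
  have hw := haarTwirl_mul_symProj_eq_smul w i₀
  have h₀ := haarTwirl_mul_symProj_eq_smul (fun _ : Fin n => i₀) i₀
  rw [haarTwirl_const_mul_symProj] at h₀
  have tw := congrArg Matrix.trace hw
  have t₀ := congrArg Matrix.trace h₀
  rw [trace_haarTwirl_mul_symProj, Matrix.trace_smul, smul_eq_mul] at tw
  rw [trace_haarTwirl, Matrix.trace_smul, smul_eq_mul] at t₀
  rw [hw, h₀, smul_smul, tw, mul_assoc, mul_comm (symProj n d).trace, ← t₀, mul_one]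

/-- The difference is the compression of the twirl of `w` to the orthogonal complement of the
symmetric subspace. -/
theorem posSemidef_haarTwirl_sub (w : Fin n → Fin d) (i₀ : Fin d) :
    (haarTwirl w - symProj n d w w • haarTwirl (fun _ => i₀)).PosSemidef := by
  have h := (posSemidef_haarTwirl w).mul_mul_conjTranspose_same (1 - symProj n d)
  have hR := haarTwirl_mul_symProj w i₀
  -- Taking adjoints, the symmetric projector also reduces the twirl from the left.
  have hL := congrArg Matrix.conjTranspose hR
  have hreal : star (symProj n d w w) = symProj n d w w := isHermitian_symProj.apply w w
  rw [Matrix.conjTranspose_mul, Matrix.conjTranspose_smul, (isHermitian_haarTwirl _).eq,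
    (isHermitian_haarTwirl _).eq, isHermitian_symProj.eq, hreal] at hL
  rw [(Matrix.isHermitian_one.sub isHermitian_symProj).eq, Matrix.sub_mul, Matrix.one_mul, hL,
    Matrix.mul_sub, Matrix.mul_one, Matrix.sub_mul, hR, Matrix.smul_mul,
    haarTwirl_const_mul_symProj, sub_self, sub_zero] at h
  exact h

/-! ### Bounds on success probabilities -/

theorem card_blockWord_eq (μ : Fin d → ℕ) (hμ : ∑ i, μ i = n) (i : Fin d) :
    Fintype.card {k // blockWord μ hμ k = i} = μ i := by
  rw [← Fintype.card_fin (μ i)]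
  refine Fintype.card_congr (Equiv.trans (Equiv.subtypeEquiv
    ((finCongr hμ.symm).trans finSigmaFinEquiv.symm) (q := fun s => s.1 = i) fun k => Iff.rfl) ?_)
  exact Equiv.sigmaSubtype i

theorem symProj_blockWord (μ : Fin d → ℕ) (hμ : ∑ i, μ i = n) :
    symProj n d (blockWord μ hμ) (blockWord μ hμ) = ((multinom μ)⁻¹ : ℝ) := by
  have h := Nat.multinomial_spec Finset.univ μ
  rw [hμ] at h
  have hp : (∏ i, ((μ i).factorial : ℂ)) ≠ 0 :=
    Finset.prod_ne_zero_iff.2 fun i _ => by exact_mod_cast (μ i).factorial_ne_zero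
  rw [symProj_apply_self, ← h, multinom]
  simp only [card_blockWord_eq]
  push_cast
  rw [_root_.mul_inv_rev, mul_assoc, inv_mul_cancel₀ hp, mul_one]

theorem outcomeProb_nonneg {P ρ : Op n d} (hP : P.PosSemidef) (hρ : ρ.PosSemidef) :
    0 ≤ outcomeProb P ρ := by
  obtain ⟨m, v, rfl⟩ := Matrix.posSemidef_iff_eq_sum_vecMulVec.1 hP
  rw [outcomeProb, Matrix.sum_mul, Matrix.trace_sum, Complex.re_sum]
  refine Finset.sum_nonneg fun i _ => ?_
  rw [Matrix.vecMulVec_mul, Matrix.trace_vecMulVec, dotProduct_comm, ← Matrix.dotProduct_mulVec]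
  exact (Complex.le_def.1 (hρ.dotProduct_mulVec_nonneg (v i))).1

theorem outcomeProb_sub (P Q ρ : Op n d) :
    outcomeProb (P - Q) ρ = outcomeProb P ρ - outcomeProb Q ρ := by
  simp [outcomeProb, Matrix.sub_mul]

theorem outcomeProb_zero (ρ : Op n d) : outcomeProb 0 ρ = 0 := by
  simp [outcomeProb]

theorem outcomeProb_one_haarTwirl (w : Fin n → Fin d) : outcomeProb 1 (haarTwirl w) = 1 := by
  simp [outcomeProb, trace_haarTwirl]

theorem outcomeProb_symProj_haarTwirl (w : Fin n → Fin d) :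
    outcomeProb (symProj n d) (haarTwirl w) = (symProj n d w w).re := by
  rw [outcomeProb, Matrix.trace_mul_comm, trace_haarTwirl_mul_symProj]

theorem symProj_const (i₀ : Fin d) : symProj n d (fun _ => i₀) (fun _ => i₀) = 1 := by
  rw [← trace_haarTwirl_mul_symProj, haarTwirl_const_mul_symProj, trace_haarTwirl]

/-- Every test answers *equal* on the unequal state with at least `1 / multinom μ` times the
probability with which it does so on the equal state. -/
theorem outcomeProb_rhoEq_le (hd : 0 < d) (μ : Fin d → ℕ) (hμ : ∑ i, μ i = n) {P : Op n d}
    (hP : P.PosSemidef) :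
    (multinom μ)⁻¹ * outcomeProb P (rhoEq n d hd) ≤ outcomeProb P (rhoNeq μ hμ) := by
  have h := outcomeProb_nonneg hP (posSemidef_haarTwirl_sub (blockWord μ hμ) ⟨0, hd⟩)
  rw [symProj_blockWord, outcomeProb, Matrix.mul_sub, Matrix.mul_smul, Matrix.trace_sub,
    Matrix.trace_smul, Complex.sub_re, smul_eq_mul, Complex.re_ofReal_mul, sub_nonneg] at h
  exact h

theorem multinom_pos (μ : Fin d → ℕ) : 0 < multinom μ := by
  exact Nat.cast_pos.2 (Nat.multinomial_pos _ _)

/-- The success probability is bounded by a function affine in the completeness `Tr[P ρ_=]`. -/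
theorem successProb_le (hd : 0 < d) (μ : Fin d → ℕ) (hμ : ∑ i, μ i = n) {p : ℝ} (hp₁ : p ≤ 1)
    {P Q : Op n d} (h : IsPOVM P Q) :
    successProb p (rhoEq n d hd) (rhoNeq μ hμ) P Q
      ≤ 1 - p + (p - (1 - p) / multinom μ) * outcomeProb P (rhoEq n d hd) := by
  obtain ⟨hPQ, hP, -⟩ := h
  have hle := mul_le_mul_of_nonneg_left (outcomeProb_rhoEq_le hd μ hμ hP) (sub_nonneg.2 hp₁)
  have h1 : outcomeProb 1 (rhoNeq μ hμ) = 1 := outcomeProb_one_haarTwirl _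
  rw [successProb, eq_sub_of_add_eq' hPQ, outcomeProb_sub, h1, div_eq_mul_inv]
  linarith

theorem outcomeProb_rhoEq_le_one (hd : 0 < d) {P Q : Op n d} (h : IsPOVM P Q) :
    outcomeProb P (rhoEq n d hd) ≤ 1 := by
  have h0 := outcomeProb_nonneg h.2.2 (posSemidef_haarTwirl fun _ : Fin n => (⟨0, hd⟩ : Fin d))
  rw [eq_sub_of_add_eq' h.1, outcomeProb_sub, outcomeProb_one_haarTwirl] at h0
  exact sub_nonneg.1 h0

theorem thresholdPrior_le_iff (μ : Fin d → ℕ) (p : ℝ) :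
    thresholdPrior μ ≤ p ↔ 0 ≤ p - (1 - p) / multinom μ := by
  have hM := multinom_pos μ
  rw [thresholdPrior, div_le_iff₀ (by positivity), sub_nonneg, div_le_iff₀ hM]
  constructor <;> intro h <;> linarith

theorem le_thresholdPrior_iff (μ : Fin d → ℕ) (p : ℝ) :
    p ≤ thresholdPrior μ ↔ p - (1 - p) / multinom μ ≤ 0 := by
  have hM := multinom_pos μ
  rw [thresholdPrior, le_div_iff₀ (by positivity), sub_nonpos, le_div_iff₀ hM]
  constructor <;> intro h <;> linarith

end QuantumIdentity

theorem theorem4p3 (n d : ℕ) (hd : 1 < d) (μ : Fin d → ℕ) (hanti : Antitone μ)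
    (hsum : ∑ i, μ i = n) (hμ₂ : 0 < μ ⟨1, hd⟩)
    (p : ℝ) (hp₀ : 0 ≤ p) (hp₁ : p ≤ 1) :
    (QuantumIdentity.thresholdPrior μ ≤ p →
      QuantumIdentity.IsOptimalPOVM p
        (QuantumIdentity.rhoEq n d (Nat.zero_lt_of_lt hd)) (QuantumIdentity.rhoNeq μ hsum)
        (QuantumIdentity.symProj n d) (1 - QuantumIdentity.symProj n d) ∧
      QuantumIdentity.successProb p
        (QuantumIdentity.rhoEq n d (Nat.zero_lt_of_lt hd)) (QuantumIdentity.rhoNeq μ hsum)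
        (QuantumIdentity.symProj n d) (1 - QuantumIdentity.symProj n d)
          = 1 - (1 - p) / QuantumIdentity.multinom μ ∧
      QuantumIdentity.outcomeProb (QuantumIdentity.symProj n d)
        (QuantumIdentity.rhoEq n d (Nat.zero_lt_of_lt hd)) = 1 ∧
      QuantumIdentity.outcomeProb (1 - QuantumIdentity.symProj n d)
        (QuantumIdentity.rhoNeq μ hsum) = 1 - 1 / QuantumIdentity.multinom μ) ∧
    (p ≤ QuantumIdentity.thresholdPrior μ →
      QuantumIdentity.IsOptimalPOVM p
        (QuantumIdentity.rhoEq n d (Nat.zero_lt_of_lt hd)) (QuantumIdentity.rhoNeq μ hsum)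
        0 1 ∧
      QuantumIdentity.successProb p
        (QuantumIdentity.rhoEq n d (Nat.zero_lt_of_lt hd)) (QuantumIdentity.rhoNeq μ hsum)
        0 1 = 1 - p ∧
      QuantumIdentity.outcomeProb 0
        (QuantumIdentity.rhoEq n d (Nat.zero_lt_of_lt hd)) = 0 ∧
      QuantumIdentity.outcomeProb 1 (QuantumIdentity.rhoNeq μ hsum) = 1) := by
  have hd₀ : 0 < d := Nat.zero_lt_of_lt hd
  have hcomp : QuantumIdentity.outcomeProb (QuantumIdentity.symProj n d)
      (QuantumIdentity.rhoEq n d hd₀) = 1 := by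
    rw [QuantumIdentity.rhoEq, QuantumIdentity.outcomeProb_symProj_haarTwirl,
      QuantumIdentity.symProj_const, Complex.one_re]
  have hone : QuantumIdentity.outcomeProb 1 (QuantumIdentity.rhoNeq μ hsum) = 1 :=
    QuantumIdentity.outcomeProb_one_haarTwirl _
  have hsound : QuantumIdentity.outcomeProb (1 - QuantumIdentity.symProj n d)
      (QuantumIdentity.rhoNeq μ hsum) = 1 - 1 / QuantumIdentity.multinom μ := by
    rw [QuantumIdentity.outcomeProb_sub, hone, QuantumIdentity.rhoNeq,
      QuantumIdentity.outcomeProb_symProj_haarTwirl, QuantumIdentity.symProj_blockWord,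
      Complex.ofReal_re, one_div]
  have hperm : QuantumIdentity.successProb p
      (QuantumIdentity.rhoEq n d hd₀) (QuantumIdentity.rhoNeq μ hsum)
      (QuantumIdentity.symProj n d) (1 - QuantumIdentity.symProj n d)
        = 1 - (1 - p) / QuantumIdentity.multinom μ := by
    rw [QuantumIdentity.successProb, hcomp, hsound]
    ring
  have htriv : QuantumIdentity.successProb p
      (QuantumIdentity.rhoEq n d hd₀) (QuantumIdentity.rhoNeq μ hsum) 0 1 = 1 - p := by
    rw [QuantumIdentity.successProb, QuantumIdentity.outcomeProb_zero, hone]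
    ring
  refine ⟨fun hp => ⟨⟨⟨add_sub_cancel _ _, QuantumIdentity.posSemidef_symProj,
    QuantumIdentity.posSemidef_one_sub_symProj⟩, fun P Q hPQ => ?_⟩, hperm, hcomp, hsound⟩,
    fun hp => ⟨⟨⟨zero_add _, Matrix.PosSemidef.zero, Matrix.PosSemidef.one⟩, fun P Q hPQ => ?_⟩,
      htriv, QuantumIdentity.outcomeProb_zero _, hone⟩⟩
  · have hle := mul_le_mul_of_nonneg_left (QuantumIdentity.outcomeProb_rhoEq_le_one hd₀ hPQ)
      ((QuantumIdentity.thresholdPrior_le_iff μ p).1 hp)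
    have := QuantumIdentity.successProb_le hd₀ μ hsum hp₁ hPQ
    rw [hperm]
    linarith
  · have hle := mul_nonpos_of_nonpos_of_nonneg
      ((QuantumIdentity.le_thresholdPrior_iff μ p).1 hp)
      (QuantumIdentity.outcomeProb_nonneg (ρ := QuantumIdentity.rhoEq n d hd₀) hPQ.2.1
        (QuantumIdentity.posSemidef_haarTwirl _))
    have := QuantumIdentity.successProb_le hd₀ μ hsum hp₁ hPQ
    rw [htriv]
    linarith
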